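/- All rings are associative and unital. A ring $R$ with center $C$ is called centrally essential if every nonzero $C$-submodule of $R$ meets $C$ nontrivially, i.e. the module $R_C$ is an essential extension of $C_C$. The socle of a module is the sum of its simple submodules, and a module is semi-Artinian if each of its factor modules is an essential extension of its socle; a ring is left (right) semi-Artinian if it is so as a left (right) module over itself. A ring $R$ is regular if $a\in aRa$ for every $a\in R$, and right nonsingular if no nonzero element of $R$ has a right annihilator that is an essential right ideal. **Theorem 1.5.** Let $R$ be a centrally essential ring with center $C$ and Jacobson radical $J(R)$. (1) If $R$ is left semi-Artinian or right semi-Artinian, then $R/J(R)$ is a commutative regular ring. (2) If $R$ is right nonsingular or $C$ is a semiprime ring (it has no nonzero ideal $I$ with $I^2=0$), then $R$ is commutative. (3) If $B$ is a proper ideal of a centrally essential ring $R$ generated by some central idempotents, and the factor ring $R/B$ has no idempotents other than $0$ and $1$, then $R/B$ need not be centrally essential. An explicit example is the following. Let $F$ be the field of three elements, let $\Lambda(F^3)$ be the exterior algebra of $F^3$, and regard $\Lambda(F^2)$ as a subalgebra of it through the inclusion $F^2\to F^3$, $(x,y)\mapsto(x,y,0)$. Let $R$ be the ring of all sequences $(a_i)_{i\in\mathbb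 N}$ in $\Lambda(F^3)$ that are eventually constant with eventual value in $\Lambda(F^2)$, with componentwise operations, let $e_i\in R$ be the sequence with $1$ in position $i$ and $0$ elsewhere, and let $B$ be the ideal of $R$ generated by all the $e_i$. Then $R$ is centrally essential, every $e_i$ is a central idempotent of $R$, $B\neq R$, the ring $R/B$ has no idempotents other than $0$ and $1$, and $R/B$ is not centrally essential. -/

import Mathlib

/-- A submodule `N` of `M` is essential (that is, `M` is an essential extension of `N`)
if it meets every non-zero submodule of `M` non-trivially. -/
def IsEssentialSubmodule {R M : Type*} [Ring R] [AddCommGroup M] [Module R M]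
    (N : Submodule R M) : Prop :=
  ∀ K : Submodule R M, K ⊓ N = ⊥ → K = ⊥

/-- The center `C` of `R`, as a `C`-submodule of `R`. -/
def centerSubmodule (R : Type*) [Ring R] : Submodule (Subring.center R) R where
  carrier := {x | x ∈ Subring.center R}
  add_mem' := fun ha hb => (Subring.center R).add_mem ha hb
  zero_mem' := (Subring.center R).zero_mem
  smul_mem' := fun c _ hx => (Subring.center R).mul_mem c.2 hx

/-- `R` is centrally essential if, for its center `C`, the `C`-module `R` is an essential
extension of `C`. (Left and right multiplication by elements of `C` coincide.) -/
def IsCentrallyEssential (R : Type*) [Ring R] : Prop :=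
  IsEssentialSubmodule (centerSubmodule R)

/-- The socle of a module: the sum of all its simple submodules. -/
def moduleSocle (R M : Type*) [Ring R] [AddCommGroup M] [Module R M] : Submodule R M :=
  sSup {N : Submodule R M | IsSimpleModule R N}

/-- A module is semi-Artinian if each of its factor modules is an essential extension of its
socle. -/
def IsSemiArtinianModule (R M : Type*) [Ring R] [AddCommGroup M] [Module R M] : Prop :=
  ∀ N : Submodule R M, IsEssentialSubmodule (moduleSocle R (M ⧸ N))

def IsLeftSemiArtinianRing (R : Type*) [Ring R] : Prop :=
  IsSemiArtinianModule R R

/-- Right `R`-modules are modules over the opposite ring. -/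
def IsRightSemiArtinianRing (R : Type*) [Ring R] : Prop :=
  IsSemiArtinianModule Rᵐᵒᵖ R

/-- Von Neumann regular rings: `a ∈ aRa` for all `a`. -/
def IsVonNeumannRegularRing (R : Type*) [Ring R] : Prop :=
  ∀ a : R, ∃ x : R, a = a * x * a

def IsCommutativeRing (R : Type*) [Ring R] : Prop :=
  ∀ x y : R, x * y = y * x

/-- The right annihilator `{r | a * r = 0}` of `a`, a right ideal of `R`. -/
def rightAnnihilator {R : Type*} [Ring R] (a : R) : Submodule Rᵐᵒᵖ R where
  carrier := {r | a * r = 0}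
  add_mem' := fun {x y} (hx : a * x = 0) (hy : a * y = 0) => by
    change a * (x + y) = 0
    rw [mul_add, hx, hy, add_zero]
  zero_mem' := mul_zero a
  smul_mem' := fun c x (hx : a * x = 0) => by
    change a * (x * c.unop) = 0
    rw [← mul_assoc, hx, zero_mul]

/-- `R` is right nonsingular if no non-zero element of `R` has an essential right annihilator. -/
def IsRightNonsingularRing (R : Type*) [Ring R] : Prop :=
  ∀ a : R, IsEssentialSubmodule (rightAnnihilator a) → a = 0

/-- `R` is semiprime if it has no non-zero two-sided ideal with zero square. -/
def IsSemiprimeRing (R : Type*) [Ring R] : Prop :=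
  ∀ I : Ideal R, I.IsTwoSided → I * I = ⊥ → I = ⊥

/-- The only idempotents of `R` are `0` and `1`. -/
def HasOnlyTrivialIdempotents (R : Type*) [Ring R] : Prop :=
  ∀ x : R, IsIdempotentElem x → x = 0 ∨ x = 1

/-- The ring `R / B`, where `B` is the two-sided ideal of `R` generated by `E`. -/
abbrev QuotientBySpan {R : Type*} [Ring R] (E : Set R) : Type _ :=
  (TwoSidedIdeal.span E).ringCon.Quotient

/-- The exterior algebra of the `n`-dimensional vector space over the field of three elements. -/
abbrev ExtF3 (n : ℕ) : Type := ExteriorAlgebra (ZMod 3) (Fin n → ZMod 3)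

/-- The exterior algebra of the plane, as the subalgebra of the exterior algebra of the
three-dimensional space that comes from the inclusion `(x, y) ↦ (x, y, 0)`. -/
noncomputable def planeSubalgebra : Subalgebra (ZMod 3) (ExtF3 3) :=
  (ExteriorAlgebra.map
    (Function.ExtendByZero.linearMap (ZMod 3) (Fin.castSucc : Fin 2 → Fin 3))).range

/-- The ring of sequences in `ExtF3 3` that are eventually constant with value in
`planeSubalgebra`. -/
def seqRing : Subring (ℕ → ExtF3 3) where
  carrier := {a | ∃ s ∈ planeSubalgebra, ∃ N : ℕ, ∀ n ≥ N, a n = s}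
  mul_mem' := by
    rintro a b ⟨s, hs, N, hN⟩ ⟨t, ht, M, hM⟩
    exact ⟨s * t, mul_mem hs ht, max N M, fun n hn => by
      rw [Pi.mul_apply, hN n (le_of_max_le_left hn), hM n (le_of_max_le_right hn)]⟩
  one_mem' := ⟨1, one_mem _, 0, fun _ _ => rfl⟩
  add_mem' := by
    rintro a b ⟨s, hs, N, hN⟩ ⟨t, ht, M, hM⟩
    exact ⟨s + t, add_mem hs ht, max N M, fun n hn => by
      rw [Pi.add_apply, hN n (le_of_max_le_left hn), hM n (le_of_max_le_right hn)]⟩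
  zero_mem' := ⟨0, zero_mem _, 0, fun _ _ => rfl⟩
  neg_mem' := by
    rintro a ⟨s, hs, N, hN⟩
    exact ⟨-s, neg_mem hs, N, fun n hn => by rw [Pi.neg_apply, hN n hn]⟩

/-- The sequence with `1` at position `i` and `0` elsewhere. -/
def seqIdem (i : ℕ) : seqRing :=
  ⟨Pi.single i 1, 0, zero_mem _, i + 1, fun n hn =>
    Pi.single_eq_of_ne (by omega) _⟩

/-! ### Central idempotents, and commutativity when the center is reduced. -/

section CentrallyEssential

variable {R : Type*} [Ring R]

/-! Central essentiality is used elementwise: each nonzero `a` has a nonzero central multiple `c *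
a` with `c` central. Hence idempotents are central, and a reduced center forces commutativity. Each
hypothesis of (2) makes the center reduced.

For (1), semi-Artinian enters as strong atomicity of the lattice of left ideals: if `N < L`, some
cover of `N` lies below `L`. The radical J kills every covering factor, so J is nil and idempotents
lift modulo J. A commutator d outside J would give a central idempotent e ≡ td mod J that generates
a minimal left ideal of R/J. A nonzero central z in a minimal left ideal inside Re satisfies Jz = 0,
and every rz turns out to be central; so dz = 0 and z = ez = tdz = 0
(`IsCentrallyEssential.mul_sub_mul_mem_jacobson`). Now R/J is commutative with zero radical and all
primes maximal, hence regular. The right-handed case passes to the opposite ring.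

For (3), parity decides. In Λ(F³) the top degree is odd yet central, and a suitable bivector carries
an element with a linear part to a nonzero central one. In Λ(F²) no central multiple of e₀ by a
central element is nonzero. Essentiality of the sequence ring is tested in a single coordinate,
where all of Λ(F³) is available, while modulo eventually zero sequences only Λ(F²) survives. -/

theorem isCentrallyEssential_iff :
    IsCentrallyEssential R ↔ ∀ a : R, a ≠ 0 →
      ∃ c ∈ Subring.center R, c * a ≠ 0 ∧ c * a ∈ Subring.center R := by
  constructor
  · intro h a ha
    by_contra! hc
    apply ha
    have key := h (Submodule.span (Subring.center R) {a}) (by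
      rw [eq_bot_iff]
      rintro x ⟨hx, hxC⟩
      obtain ⟨c, rfl⟩ := Submodule.mem_span_singleton.1 hx
      by_contra hne
      exact hc c c.2 hne hxC)
    exact Submodule.span_singleton_eq_bot.1 key
  · intro h K hK
    rw [eq_bot_iff]
    intro x hx
    by_contra hne
    obtain ⟨c, hc, h0, hcx⟩ := h x hne
    have : c * x ∈ K ⊓ centerSubmodule R := ⟨K.smul_mem ⟨c, hc⟩ hx, hcx⟩
    rw [hK] at this
    exact h0 this

theorem IsCentrallyEssential.op (h : IsCentrallyEssential R) : IsCentrallyEssential Rᵐᵒᵖ := by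
  rw [isCentrallyEssential_iff] at h ⊢
  intro a ha
  obtain ⟨c, hc, h0, hca⟩ := h a.unop (by simpa using ha)
  rw [Subring.mem_center_iff] at hc hca
  refine ⟨MulOpposite.op c, ?_, ?_, ?_⟩
  · rw [Subring.mem_center_iff]
    intro g
    apply MulOpposite.unop_injective
    simpa using (hc g.unop).symm
  · intro h1
    apply h0
    rw [← hc]
    simpa using congrArg MulOpposite.unop h1
  · rw [Subring.mem_center_iff]
    intro g
    apply MulOpposite.unop_injective
    have := (hca g.unop).symm
    rw [← hc] at this
    simpa using this

theorem IsCentrallyEssential.of_ringEquiv {S : Type*} [Ring S] (e : R ≃+* S)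
    (h : IsCentrallyEssential R) : IsCentrallyEssential S := by
  rw [isCentrallyEssential_iff] at h ⊢
  have hmap : ∀ c ∈ Subring.center R, e c ∈ Subring.center S := by
    intro c hc
    rw [Subring.mem_center_iff] at hc ⊢
    intro g
    obtain ⟨g, rfl⟩ := e.surjective g
    rw [← map_mul, ← map_mul, hc]
  intro a ha
  obtain ⟨c, hc, h0, hca⟩ := h (e.symm a) (by simpa using ha)
  have hea : e (c * e.symm a) = e c * a := by simp
  refine ⟨e c, hmap c hc, ?_, ?_⟩
  · rw [← hea]
    exact (map_ne_zero_iff e e.injective).2 h0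
  · rw [← hea]
    exact hmap _ hca

/-- A central multiple w = c(erf) satisfies w = ew = we, and we = 0 because fe = 0. -/
theorem IsCentrallyEssential.mul_mul_eq_zero_of_mul_eq_zero (h : IsCentrallyEssential R) {e f : R}
    (hef : f * e = 0) (he : e * e = e) (r : R) : e * r * f = 0 := by
  by_contra hne
  obtain ⟨c, hc, h0, hcx⟩ := isCentrallyEssential_iff.1 h _ hne
  rw [Subring.mem_center_iff] at hc hcx
  apply h0
  calc c * (e * r * f) = e * (c * (e * r * f)) := by
        rw [← mul_assoc e c, hc e, mul_assoc c e, ← mul_assoc e, ← mul_assoc e, he]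
    _ = c * (e * r * f) * e := hcx e
    _ = 0 := by simp [mul_assoc, hef]

theorem IsCentrallyEssential.idempotent_mem_center (h : IsCentrallyEssential R) {e : R}
    (he : IsIdempotentElem e) : e ∈ Subring.center R := by
  rw [Subring.mem_center_iff]
  intro r
  have he' : e * e = e := he
  have h1 := h.mul_mul_eq_zero_of_mul_eq_zero (e := e) (f := 1 - e) (by simp [sub_mul, he']) he' r
  have h2 := h.mul_mul_eq_zero_of_mul_eq_zero (e := 1 - e) (f := e) (by simp [mul_sub, he'])
    (by simp [mul_sub, sub_mul, he']) r
  rw [mul_sub, mul_one, sub_eq_zero] at h1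
  rw [sub_mul, one_mul, sub_mul, sub_eq_zero] at h2
  exact h2.trans h1.symm

/-- The annihilator of z is essential: Kz lies in K and in the annihilator, and if Kz = 0 then K
itself does. -/
theorem IsRightNonsingularRing.eq_zero_of_sq_eq_zero (h : IsRightNonsingularRing R) {z : R}
    (hz : z ∈ Subring.center R) (hzz : z * z = 0) : z = 0 := by
  rw [Subring.mem_center_iff] at hz
  apply h
  intro K hK
  rw [eq_bot_iff]
  intro k hk
  have hkz : k * z ∈ K ⊓ rightAnnihilator z := by
    refine ⟨K.smul_mem (MulOpposite.op z) hk, ?_⟩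
    change z * (k * z) = 0
    rw [hz k, ← mul_assoc, hzz, zero_mul]
  rw [hK, Submodule.mem_bot] at hkz
  have : k ∈ K ⊓ rightAnnihilator z := ⟨hk, by change z * k = 0; rw [← hz, hkz]⟩
  rwa [hK] at this

theorem IsSemiprimeRing.eq_zero_of_sq_eq_zero (h : IsSemiprimeRing (Subring.center R)) {z : R}
    (hz : z ∈ Subring.center R) (hzz : z * z = 0) : z = 0 := by
  have key := h (Ideal.span {⟨z, hz⟩}) inferInstance (by
    rw [Ideal.span_singleton_mul_span_singleton, Ideal.span_singleton_eq_bot]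
    exact Subtype.ext hzz)
  exact congrArg Subtype.val (Ideal.span_singleton_eq_bot.1 key)

/-- Let z be a nonzero central multiple of xy - yx. Any central b with bx central kills z. If zx =
0, take b = z; otherwise choose b with bzx nonzero central, so that bz kills z and (bz)² = 0. -/
theorem IsCentrallyEssential.isCommutativeRing_of_reduced_center (h : IsCentrallyEssential R)
    (hred : ∀ z ∈ Subring.center R, z * z = 0 → z = 0) : IsCommutativeRing R := by
  rw [isCentrallyEssential_iff] at h
  intro x y
  by_contra hne
  obtain ⟨c, hc, hz0, hz⟩ := h (x * y - y * x) (sub_ne_zero.2 hne)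
  set z := c * (x * y - y * x) with hzdef
  have hI : ∀ b ∈ Subring.center R, b * x ∈ Subring.center R → b * z = 0 := by
    intro b hb hbx
    rw [Subring.mem_center_iff] at hb hbx hc
    have : b * (x * y - y * x) = 0 := by
      rw [mul_sub, ← mul_assoc, ← mul_assoc, ← hbx y, ← hb y, mul_assoc, sub_self]
    rw [hzdef, ← mul_assoc, hc b, mul_assoc, this, mul_zero]
  by_cases hzx : z * x = 0
  · exact hz0 (hred z hz (hI z hz (by rw [hzx]; exact zero_mem _)))
  · obtain ⟨b, hb, hb0, hbzx⟩ := h _ hzx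
    have hbz : b * z ∈ Subring.center R := mul_mem hb hz
    have h1 : b * z * z = 0 := hI _ hbz (by rwa [mul_assoc])
    have h2 : b * z = 0 := hred _ hbz (by
      rw [← mul_assoc, mul_assoc b z b, ← (Subring.mem_center_iff.1 hz b), mul_assoc, mul_assoc,
        ← mul_assoc b z z, h1, mul_zero])
    exact hb0 (by rw [← mul_assoc, h2, zero_mul])

end CentrallyEssential

/-! ### Semi-Artinian rings: covers of left ideals, the radical, and commutators. -/

section SemiArtinian

variable {R : Type*} [Ring R]

/-- L/N meets the semisimple socle of M/N, so it contains a simple submodule, whose preimage covers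
N. -/
theorem IsSemiArtinianModule.isStronglyAtomic {M : Type*} [AddCommGroup M] [Module R M]
    (h : IsSemiArtinianModule R M) : IsStronglyAtomic (Submodule R M) where
  exists_covBy_le_of_lt N L hNL := by
    have hmap : moduleSocle R (M ⧸ N) ⊓ L.map N.mkQ ≠ ⊥ := by
      intro hbot
      have h1 := h N (L.map N.mkQ) (by rw [inf_comm]; exact hbot)
      rw [Submodule.eq_bot_iff] at h1
      refine hNL.not_ge fun x hx => ?_
      rw [← Submodule.ker_mkQ N]
      exact h1 _ (Submodule.mem_map_of_mem hx)
    have hss : IsSemisimpleModule R (moduleSocle R (M ⧸ N)) := by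
      rw [moduleSocle, sSup_eq_iSup]
      exact isSemisimpleModule_biSup_of_isSemisimpleModule_submodule fun S hS => by
        have : IsSimpleModule R S := hS
        infer_instance
    have : IsSemisimpleModule R ↥(moduleSocle R (M ⧸ N) ⊓ L.map N.mkQ) :=
      IsSemisimpleModule.of_injective (Submodule.inclusion inf_le_left)
        (Submodule.inclusion_injective _)
    obtain ⟨A, hA, hsimple⟩ :=
      (IsSemisimpleModule.eq_bot_or_exists_simple_le
        (moduleSocle R (M ⧸ N) ⊓ L.map N.mkQ)).resolve_left hmap
    have hatom := isSimpleModule_iff_isAtom.1 hsimple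
    refine ⟨A.comap N.mkQ, ?_, ?_⟩
    · have hker : N ≤ A.comap N.mkQ := by
        conv_lhs => rw [← Submodule.ker_mkQ N]
        exact LinearMap.ker_le_comap _
      have hback : ∀ P : Submodule R M, N ≤ P → (P.map N.mkQ).comap N.mkQ = P := by
        intro P hP
        rw [Submodule.comap_map_mkQ, sup_eq_right.2 hP]
      refine (wcovBy_of_eq_or_eq hker fun P hNP hPA => ?_).covBy_of_not_le ?_
      · rcases hatom.le_iff.1 (Submodule.map_le_iff_le_comap.2 hPA) with h0 | h0
        · left
          rw [← hback P hNP, h0, Submodule.comap_bot, Submodule.ker_mkQ]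
        · right
          rw [← hback P hNP, h0]
      · intro hle
        apply hatom.1
        rw [← Submodule.map_comap_eq_of_surjective (Submodule.mkQ_surjective N) A, eq_bot_iff]
        refine (Submodule.map_mono hle).trans ?_
        rw [Submodule.map_le_iff_le_comap]
        exact (Submodule.ker_mkQ N).ge
    · intro x hx
      obtain ⟨y, hy, hyx⟩ := (hA hx).2
      have : x - y ∈ N := by
        rw [← Submodule.ker_mkQ N, LinearMap.mem_ker, map_sub, hyx, sub_self]
      simpa using L.add_mem (hNL.le this) hy

theorem exists_sub_mul_mem_of_covBy {N K : Ideal R} (h : N ⋖ K) {s k : R} (hsK : s ∈ K)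
    (hs : s ∉ N) (hk : k ∈ K) : ∃ t, k - t * s ∈ N := by
  have hsup : N ⊔ Ideal.span {s} = K := by
    refine (h.eq_or_eq le_sup_left (sup_le h.le ?_)).resolve_left ?_
    · rwa [Ideal.span_singleton_le_iff_mem]
    · intro h1
      apply hs
      rw [← h1]
      exact Ideal.mem_sup_right (Ideal.mem_span_singleton_self s)
  rw [← hsup] at hk
  obtain ⟨n, hn, y, hy, rfl⟩ := Submodule.mem_sup.1 hk
  obtain ⟨t, rfl⟩ := Ideal.mem_span_singleton'.1 hy
  exact ⟨t, by simpa using hn⟩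

theorem exists_mul_one_sub_eq_one {j : R} (hj : j ∈ Ring.jacobson R) : ∃ t, t * (1 - j) = 1 := by
  by_contra! hne
  have htop : Ideal.span {1 - j} ≠ ⊤ := by
    rw [Ne, Ideal.eq_top_iff_one]
    intro h1
    obtain ⟨t, ht⟩ := Ideal.mem_span_singleton'.1 h1
    exact hne t ht
  obtain ⟨m, hm, hle⟩ := Ideal.exists_le_maximal _ htop
  have h1 : 1 - j ∈ m := hle (Ideal.mem_span_singleton_self _)
  have h2 : j ∈ m := Ring.jacobson_le_of_isMaximal m hj
  exact hm.ne_top ((Ideal.eq_top_iff_one m).2 (by simpa using m.add_mem h1 h2))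

theorem mem_jacobson_of_forall_exists {x : R} (h : ∀ r, ∃ t, t * (1 - r * x) = 1) :
    x ∈ Ring.jacobson R := by
  rw [Ring.jacobson_eq_sInf_isMaximal, Submodule.mem_sInf]
  intro m hm
  by_contra hx
  obtain ⟨n, hn, y, hy, hny⟩ := Submodule.mem_sup.1
    ((Ideal.eq_top_iff_one _).1 (hm.1.2 (m ⊔ Ideal.span {x})
      (lt_of_le_of_ne le_sup_left fun h1 => hx (by
        rw [h1]; exact Ideal.mem_sup_right (Ideal.mem_span_singleton_self x)))))
  obtain ⟨r, rfl⟩ := Ideal.mem_span_singleton'.1 hy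
  obtain ⟨t, ht⟩ := h r
  rw [← hny, add_sub_cancel_right] at ht
  exact hm.ne_top ((Ideal.eq_top_iff_one m).2 (by rw [← hny, ← ht]; exact Ideal.mul_mem_left m t hn))

theorem mem_jacobson_of_op_mem {x : R} (hx : MulOpposite.op x ∈ Ring.jacobson Rᵐᵒᵖ) :
    x ∈ Ring.jacobson R := by
  apply mem_jacobson_of_forall_exists
  intro r
  have hmem : MulOpposite.op (r * x) ∈ Ring.jacobson Rᵐᵒᵖ := by
    rw [MulOpposite.op_mul]
    exact (Ring.jacobson Rᵐᵒᵖ).mul_mem_right _ hx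
  obtain ⟨t, ht⟩ := exists_mul_one_sub_eq_one hmem
  -- The left inverse t is congruent to 1 modulo J, so it has a left inverse too and is therefore a
  -- two-sided inverse.
  obtain ⟨u, hu⟩ := exists_mul_one_sub_eq_one (j := 1 - t) (by
    have : 1 - t = -(t * MulOpposite.op (r * x)) := by
      rw [mul_sub, mul_one] at ht
      rw [← ht]; abel
    rw [this]
    exact neg_mem (Ideal.mul_mem_left _ t hmem))
  rw [sub_sub_cancel] at hu
  have hinv : (1 - MulOpposite.op (r * x)) * t = 1 := by
    rw [← left_inv_eq_right_inv hu ht, hu]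
  exact ⟨t.unop, by simpa using congrArg MulOpposite.unop hinv⟩

/-- If jk generated the simple module K/N, then k ≡ tjk, and 1 - tj is left invertible. -/
theorem jacobson_mul_mem_of_covBy {N K : Ideal R} (h : N ⋖ K) {j k : R}
    (hj : j ∈ Ring.jacobson R) (hk : k ∈ K) : j * k ∈ N := by
  by_contra hjk
  obtain ⟨t, ht⟩ := exists_sub_mul_mem_of_covBy h (K.mul_mem_left j hk) hjk hk
  obtain ⟨u, hu⟩ := exists_mul_one_sub_eq_one (Ideal.mul_mem_left _ t hj)
  apply hjk
  apply N.mul_mem_left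
  have : k = u * (k - t * (j * k)) := by
    rw [← mul_assoc, ← one_sub_mul, ← mul_assoc, hu, one_mul]
  rw [this]
  exact N.mul_mem_left u ht

/-- Since (1 + rk)(1 - rk) = 1 - (rk)², squares in J would make every 1 - rk left invertible. -/
theorem exists_mul_self_notMem_jacobson {k : R} (hk : k ∉ Ring.jacobson R) :
    ∃ r, r * k * (r * k) ∉ Ring.jacobson R := by
  by_contra! h
  apply hk
  apply mem_jacobson_of_forall_exists
  intro r
  obtain ⟨t, ht⟩ := exists_mul_one_sub_eq_one (h r)
  refine ⟨t * (1 + r * k), ?_⟩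
  calc t * (1 + r * k) * (1 - r * k) = t * (1 - r * k * (r * k)) := by noncomm_ring
    _ = 1 := ht

variable (R) in
theorem isNilpotent_of_mem_jacobson [IsStronglyAtomic (Ideal R)] {a : R}
    (ha : a ∈ Ring.jacobson R) : IsNilpotent a := by
  by_contra hnil
  have hpow : ∀ n : ℕ, a ^ n ≠ 0 := fun n hn => hnil ⟨n, hn⟩
  -- A left ideal N maximal among those avoiding all powers of a; a cover of N contains some aⁿ, and
  -- then aⁿ⁺¹ falls into N.
  obtain ⟨N, -, hN⟩ := zorn_le_nonempty₀ {I : Ideal R | ∀ n : ℕ, a ^ n ∉ I} (by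
    intro c hc hchain I hI
    refine ⟨sSup c, ?_, fun z hz => le_sSup hz⟩
    intro n hn
    rw [Submodule.mem_sSup_of_directed ⟨I, hI⟩ hchain.directedOn] at hn
    obtain ⟨I', hI', hn'⟩ := hn
    exact hc hI' n hn') ⊥ (fun n hn => hpow n hn)
  have hNtop : N < ⊤ := lt_top_iff_ne_top.2 fun h1 => hN.1 0 (by rw [h1]; trivial)
  obtain ⟨K, hNK, -⟩ := exists_covBy_le_of_lt hNtop
  have hK : ¬ ∀ n : ℕ, a ^ n ∉ K := fun h1 => hNK.lt.not_ge (hN.2 h1 hNK.le)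
  push Not at hK
  obtain ⟨n, hn⟩ := hK
  exact hN.1 (n + 1) (by rw [pow_succ']; exact jacobson_mul_mem_of_covBy hNK ha hn)

/-- Modulo the radical, every non-zero left ideal of a left semi-Artinian ring contains a
primitive idempotent, which lifts to an idempotent of the ring. -/
theorem exists_isIdempotentElem_of_notMem_jacobson [IsStronglyAtomic (Ideal R)] {d : R}
    (hd : d ∉ Ring.jacobson R) :
    ∃ e : R, IsIdempotentElem e ∧ e ∉ Ring.jacobson R ∧ (∃ t, e - t * d ∈ Ring.jacobson R) ∧
      ∀ c, c * e ∉ Ring.jacobson R → ∃ u, e - u * (c * e) ∈ Ring.jacobson R := by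
  set J := Ring.jacobson R with hJ
  have hlt : J < J ⊔ Ideal.span {d} := lt_of_le_of_ne le_sup_left fun h1 => hd (by
    rw [h1]; exact Ideal.mem_sup_right (Ideal.mem_span_singleton_self d))
  obtain ⟨K, hJK, hKd⟩ := exists_covBy_le_of_lt hlt
  obtain ⟨k, hkK, hkJ⟩ := SetLike.exists_of_lt hJK.lt
  obtain ⟨r, hr⟩ := exists_mul_self_notMem_jacobson hkJ
  set m := r * k with hm
  have hmK : m ∈ K := K.mul_mem_left r hkK
  have hmJ : m ∉ J := fun h1 => hr (J.mul_mem_left m h1)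
  obtain ⟨t, ht⟩ := exists_sub_mul_mem_of_covBy hJK (K.mul_mem_left m hmK) hr hmK
  -- Brauer's argument: as m² ∉ J, right multiplication by m is injective on the simple module K/J,
  -- so m ≡ tm² makes tm idempotent modulo J.
  have hinj : ∀ x ∈ K, x * m ∈ J → x ∈ J := by
    intro x hx hxm
    by_contra hxJ
    obtain ⟨s, hs⟩ := exists_sub_mul_mem_of_covBy hJK hx hxJ hmK
    apply hr
    have : m * m = (m - s * x) * m + s * (x * m) := by noncomm_ring
    rw [this]
    exact J.add_mem (J.mul_mem_right _ hs) (J.mul_mem_left s hxm)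
  have he0K : t * m ∈ K := K.mul_mem_left t hmK
  have hidem : t * m * (t * m) - t * m ∈ J := by
    apply hinj _ (K.sub_mem (K.mul_mem_left _ he0K) he0K)
    have : (t * m * (t * m) - t * m) * m = (1 - t * m) * (m - t * (m * m)) - (m - t * (m * m)) := by
      noncomm_ring
    rw [this]
    exact J.sub_mem (J.mul_mem_left _ ht) ht
  obtain ⟨e, he, hee⟩ := exists_isIdempotentElem_eq_of_ker_isNilpotent (Ideal.Quotient.mk J)
    (fun x hx => isNilpotent_of_mem_jacobson R (by rwa [Ideal.mk_ker] at hx))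
    (Ideal.Quotient.mk J (t * m)) ⟨_, rfl⟩ (by
      rw [IsIdempotentElem, ← map_mul, Ideal.Quotient.eq]
      exact hidem)
  rw [Ideal.Quotient.eq] at hee
  have heK : e ∈ K := by simpa using K.add_mem (hJK.le hee) he0K
  refine ⟨e, he, ?_, ?_, ?_⟩
  · intro heJ
    apply hmJ
    have h1 : t * m ∈ J := by simpa using J.sub_mem heJ hee
    have : m = (m - t * (m * m)) + t * m * m := by noncomm_ring
    rw [this]
    exact J.add_mem ht (J.mul_mem_right _ h1)
  · obtain ⟨n, hn, y, hy, hny⟩ := Submodule.mem_sup.1 (hKd heK)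
    obtain ⟨s, rfl⟩ := Ideal.mem_span_singleton'.1 hy
    exact ⟨s, by rw [← hny]; simpa using hn⟩
  · intro c hc
    exact exists_sub_mul_mem_of_covBy hJK (K.mul_mem_left c heK) hc heK

theorem IsCentrallyEssential.mul_sub_mul_mem_jacobson [IsStronglyAtomic (Ideal R)]
    (h : IsCentrallyEssential R) (x y : R) : x * y - y * x ∈ Ring.jacobson R := by
  by_contra hd
  obtain ⟨e, he, heJ, ⟨t, ht⟩, hprim⟩ := exists_isIdempotentElem_of_notMem_jacobson hd
  have hec := h.idempotent_mem_center he
  rw [isCentrallyEssential_iff] at h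
  rw [Subring.mem_center_iff] at hec
  have he' : e * e = e := he
  have hlt : (⊥ : Ideal R) < Ideal.span {e} := bot_lt_iff_ne_bot.2 fun h1 => heJ (by
    rw [Ideal.span_singleton_eq_bot.1 h1]; exact zero_mem _)
  obtain ⟨K, hK, hKe⟩ := exists_covBy_le_of_lt hlt
  obtain ⟨s, hsK, hs0⟩ := SetLike.exists_of_lt hK.lt
  obtain ⟨c, hc, hz0, hz⟩ := h s hs0
  have hzK : c * s ∈ K := K.mul_mem_left c hsK
  generalize c * s = z at hz0 hz hzK
  have hzC := Subring.mem_center_iff.1 hz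
  have hJz : ∀ j ∈ Ring.jacobson R, j * z = 0 := fun j hj => jacobson_mul_mem_of_covBy hK hj hzK
  have hez : e * z = z := by
    obtain ⟨w, hw⟩ := Ideal.mem_span_singleton'.1 (hKe hzK)
    rw [← hw, hec, ← mul_assoc, he']
  -- Choose b central with brz nonzero and central: b kills the commutator [g, rz] = [g, r]z. As be
  -- ∉ J, e ≡ ube modulo J for some u, and J kills z, so [g, rz] = ub[g, rz] = 0.
  have hcentral : ∀ r g : R, g * (r * z) = r * z * g := by
    intro r g
    by_cases hrz : r * z = 0
    · simp [hrz]
    obtain ⟨b, hb, hb0, hbz⟩ := h _ hrz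
    rw [Subring.mem_center_iff] at hb hbz
    have hbe : b * e ∉ Ring.jacobson R := by
      intro h1
      apply hb0
      rw [← hez, ← mul_assoc r, hec r, mul_assoc e, ← mul_assoc, ← mul_assoc]
      exact hJz _ (Ideal.mul_mem_right r _ h1)
    obtain ⟨u, hu⟩ := hprim b hbe
    have hw : b * (g * (r * z) - r * z * g) = 0 := by
      rw [mul_sub, ← mul_assoc, ← hb g, mul_assoc, hbz, mul_assoc b, sub_self]
    have hww : g * (r * z) - r * z * g = (g * r - r * g) * z := by
      rw [sub_mul, mul_assoc g, mul_assoc r z, ← hzC g, mul_assoc r g]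
    rw [← sub_eq_zero]
    have h2 : (e - u * (b * e)) * (g * (r * z) - r * z * g) = 0 := by
      rw [hww, ← mul_assoc]
      exact hJz _ (Ideal.mul_mem_right _ _ hu)
    have h3 : e * (g * (r * z) - r * z * g) = g * (r * z) - r * z * g := by
      rw [hww, ← mul_assoc, ← hec, mul_assoc, hez]
    rw [sub_mul, h3, mul_assoc u, mul_assoc b, h3, hw, mul_zero, sub_zero] at h2
    exact h2
  apply hz0
  have h4 : (x * y - y * x) * z = 0 := by
    rw [sub_mul, mul_assoc, hcentral y x, mul_assoc y z x, ← hzC x, mul_assoc, sub_self]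
  have h5 := hJz _ ht
  rwa [sub_mul, hez, mul_assoc, h4, mul_zero, sub_zero] at h5

/-! ### Regularity of the commutative quotient by the radical. -/

theorem Ideal.IsPrime.isMaximal_of_isStronglyAtomic {S : Type*} [CommRing S]
    [IsStronglyAtomic (Ideal S)] {P : Ideal S} (hP : P.IsPrime) : P.IsMaximal := by
  obtain ⟨K, hPK, -⟩ := exists_covBy_le_of_lt (lt_top_iff_ne_top.2 hP.ne_top)
  obtain ⟨k, hkK, hkP⟩ := SetLike.exists_of_lt hPK.lt
  rw [Ideal.isMaximal_iff]
  refine ⟨(Ideal.ne_top_iff_one P).1 hP.ne_top, fun I s hPI hsP hsI => ?_⟩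
  have hsk : s * k ∉ P := fun h => (hP.mem_or_mem h).elim hsP hkP
  obtain ⟨t, ht⟩ := exists_sub_mul_mem_of_covBy hPK (K.mul_mem_left s hkK) hsk hkK
  have h1 : k * (1 - t * s) ∈ P := by
    convert ht using 1
    ring
  have h2 := I.add_mem (hPI ((hP.mem_or_mem h1).resolve_left hkP)) (I.mul_mem_left t hsI)
  rwa [sub_add_cancel] at h2

/-- A prime disjoint from the monoid of all aⁿ(1 - ax) would omit a, yet, being maximal, contain
some 1 - ax. So 0 lies in the monoid, which makes a(1 - ax) nilpotent. -/
theorem exists_isNilpotent_sub_mul_mul {S : Type*} [CommRing S]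
    (hmax : ∀ P : Ideal S, P.IsPrime → P.IsMaximal) (a : S) :
    ∃ x, IsNilpotent (a - a * x * a) := by
  let M : Submonoid S :=
    { carrier := {y | ∃ (n : ℕ) (x : S), y = a ^ n * (1 - a * x)}
      one_mem' := ⟨0, 0, by simp⟩
      mul_mem' := by
        rintro _ _ ⟨n, x, rfl⟩ ⟨m, y, rfl⟩
        exact ⟨n + m, x + y - a * x * y, by ring⟩ }
  by_cases h0 : (0 : S) ∈ M
  · obtain ⟨n, x, hx⟩ := h0
    refine ⟨x, n + 1, ?_⟩
    calc (a - a * x * a) ^ (n + 1) = a * (1 - a * x) ^ n * (a ^ n * (1 - a * x)) := by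
          rw [show a - a * x * a = a * (1 - a * x) by ring, mul_pow]; ring
      _ = 0 := by rw [← hx, mul_zero]
  · exfalso
    obtain ⟨P, hP, -, hdisj⟩ := Ideal.exists_le_prime_disjoint (⊥ : Ideal S) M (by
      rw [Set.disjoint_left]
      rintro y hy hyM
      rw [SetLike.mem_coe, Ideal.mem_bot] at hy
      exact h0 (hy ▸ hyM))
    rw [Set.disjoint_left] at hdisj
    have haP : a ∉ P := fun ha => hdisj ha ⟨1, 0, by simp⟩
    have := hmax P hP
    obtain ⟨x, hx⟩ := (hmax P hP).exists_inv haP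
    obtain ⟨p, hp, hxp⟩ := hx
    have : (1 : S) - a * x ∈ P := by
      have : 1 - a * x = p := by rw [← hxp]; ring
      rwa [this]
    exact hdisj this ⟨0, x, by simp⟩

theorem isVonNeumannRegularRing_of_comm [IsStronglyAtomic (Ideal R)]
    (hcomm : IsCommutativeRing R) (hJ : Ring.jacobson R = ⊥) : IsVonNeumannRegularRing R := by
  -- Extending the given ring structure keeps the ideals and the radical the same.
  let _ : CommRing R := { ‹Ring R› with mul_comm := fun a b => hcomm a b }
  intro a
  obtain ⟨x, hx⟩ := exists_isNilpotent_sub_mul_mul (S := R)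
    (fun P hP => hP.isMaximal_of_isStronglyAtomic) a
  refine ⟨x, sub_eq_zero.1 ?_⟩
  have hmem : a - a * x * a ∈ Ring.jacobson R := by
    rw [Ring.jacobson_eq_sInf_isMaximal, Submodule.mem_sInf]
    intro m hm
    obtain ⟨n, hn⟩ := hx
    exact hm.isPrime.mem_of_pow_mem n (by rw [hn]; exact m.zero_mem)
  rwa [hJ, Ideal.mem_bot] at hmem

theorem isStronglyAtomic_ideal_quotient [IsStronglyAtomic (Ideal R)] (I : Ideal R)
    [I.IsTwoSided] : IsStronglyAtomic (Ideal (R ⧸ I)) where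
  exists_covBy_le_of_lt A B hAB := by
    have hsurj : Function.Surjective (Ideal.Quotient.mk I) := Ideal.Quotient.mk_surjective
    have hmono : Function.Injective (Ideal.comap (Ideal.Quotient.mk I)) :=
      Ideal.comap_injective_of_surjective _ hsurj
    have hlt : A.comap (Ideal.Quotient.mk I) < B.comap (Ideal.Quotient.mk I) :=
      lt_of_le_of_ne (Ideal.comap_mono hAB.le) fun h => hAB.ne (hmono h)
    obtain ⟨K, hK, hKB⟩ := exists_covBy_le_of_lt hlt
    have hIA : I ≤ A.comap (Ideal.Quotient.mk I) := fun x hx => by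
      rw [Ideal.mem_comap, Ideal.Quotient.eq_zero_iff_mem.2 hx]
      exact A.zero_mem
    have hback : (K.map (Ideal.Quotient.mk I)).comap (Ideal.Quotient.mk I) = K := by
      rw [Ideal.comap_map_of_surjective' _ hsurj, Ideal.mk_ker, sup_eq_left]
      exact hIA.trans hK.le
    refine ⟨K.map (Ideal.Quotient.mk I), ?_, Ideal.map_le_iff_le_comap.2 hKB⟩
    have hle : A ≤ K.map (Ideal.Quotient.mk I) := by
      rw [← Ideal.map_comap_of_surjective _ hsurj A]
      exact Ideal.map_mono hK.le
    refine (wcovBy_of_eq_or_eq hle fun P hAP hPK => ?_).covBy_of_not_le fun hKA => ?_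
    · refine (hK.eq_or_eq (Ideal.comap_mono hAP) ?_).imp (fun h => hmono h) fun h => ?_
      · exact (Ideal.comap_mono hPK).trans hback.le
      · exact hmono (h.trans hback.symm)
    · exact hK.lt.not_ge (hback.ge.trans (Ideal.comap_mono hKA))

theorem isCommutativeRing_quotient {I : Ideal R} [I.IsTwoSided]
    (h : ∀ x y : R, x * y - y * x ∈ I) : IsCommutativeRing (R ⧸ I) := by
  intro x y
  obtain ⟨x, rfl⟩ := Ideal.Quotient.mk_surjective x
  obtain ⟨y, rfl⟩ := Ideal.Quotient.mk_surjective y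
  rw [← map_mul, ← map_mul, Ideal.Quotient.eq]
  exact h x y

theorem IsCentrallyEssential.exists_sub_mul_mul_mem_jacobson [IsStronglyAtomic (Ideal R)]
    (h : IsCentrallyEssential R) (a : R) : ∃ x, a - a * x * a ∈ Ring.jacobson R := by
  have := isStronglyAtomic_ideal_quotient (Ring.jacobson R)
  obtain ⟨x, hx⟩ := isVonNeumannRegularRing_of_comm
    (isCommutativeRing_quotient h.mul_sub_mul_mem_jacobson) (Ring.jacobson_quotient_jacobson R)
    (Ideal.Quotient.mk _ a)
  obtain ⟨x, rfl⟩ := Ideal.Quotient.mk_surjective x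
  rw [← map_mul, ← map_mul, Ideal.Quotient.eq] at hx
  exact ⟨x, hx⟩

theorem IsRightSemiArtinianRing.isStronglyAtomic_op (h : IsRightSemiArtinianRing R) :
    IsStronglyAtomic (Ideal Rᵐᵒᵖ) where
  exists_covBy_le_of_lt A B hAB := by
    have := IsSemiArtinianModule.isStronglyAtomic h
    let f : R ≃ₗ[Rᵐᵒᵖ] Rᵐᵒᵖ :=
      { MulOpposite.opAddEquiv with map_smul' := fun c x => MulOpposite.op_mul x c.unop }
    let g := Submodule.orderIsoMapComap f.symm
    obtain ⟨K, hK, hKB⟩ := exists_covBy_le_of_lt (g.strictMono hAB)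
    refine ⟨g.symm K, ?_, ?_⟩
    · rwa [← apply_covBy_apply_iff g, g.apply_symm_apply]
    · rwa [g.symm_apply_le]

theorem IsCentrallyEssential.quotient_jacobson (hce : IsCentrallyEssential R)
    (h : IsLeftSemiArtinianRing R ∨ IsRightSemiArtinianRing R) :
    IsCommutativeRing (R ⧸ Ring.jacobson R) ∧ IsVonNeumannRegularRing (R ⧸ Ring.jacobson R) := by
  have key : (∀ x y : R, x * y - y * x ∈ Ring.jacobson R) ∧
      ∀ a : R, ∃ x, a - a * x * a ∈ Ring.jacobson R := by
    rcases h with h | h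
    · have := IsSemiArtinianModule.isStronglyAtomic h
      exact ⟨hce.mul_sub_mul_mem_jacobson, hce.exists_sub_mul_mul_mem_jacobson⟩
    · have := h.isStronglyAtomic_op
      refine ⟨fun x y => mem_jacobson_of_op_mem ?_, fun a => ?_⟩
      -- The arguments are swapped because the opposite product reverses the order.
      · exact hce.op.mul_sub_mul_mem_jacobson (MulOpposite.op y) (MulOpposite.op x)
      · obtain ⟨x, hx⟩ := hce.op.exists_sub_mul_mul_mem_jacobson (MulOpposite.op a)
        refine ⟨x.unop, mem_jacobson_of_op_mem ?_⟩
        simpa [mul_assoc] using hx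
  refine ⟨isCommutativeRing_quotient key.1, fun a => ?_⟩
  obtain ⟨a, rfl⟩ := Ideal.Quotient.mk_surjective a
  obtain ⟨x, hx⟩ := key.2 a
  exact ⟨Ideal.Quotient.mk _ x, by rwa [← map_mul, ← map_mul, Ideal.Quotient.eq]⟩

end SemiArtinian
-- The exterior algebra of F³ is centrally essential.
section Exterior

/-- The standard generators of the exterior algebra of the three-dimensional space. -/
noncomputable def extGen (i : Fin 3) : ExtF3 3 := ExteriorAlgebra.ι (ZMod 3) (Pi.single i 1)

theorem extGen_sq (i : Fin 3) : extGen i * extGen i = 0 := ExteriorAlgebra.ι_sq_zero _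

theorem extGen_anticomm (i j : Fin 3) : extGen j * extGen i = -(extGen i * extGen j) :=
  eq_neg_of_add_eq_zero_right (ExteriorAlgebra.ι_add_mul_swap _ _)

theorem extGen_prod_ne_zero : extGen 0 * (extGen 1 * extGen 2) ≠ 0 := by
  intro h
  -- The functional equal to the determinant in degree 3 and zero in other degrees takes the value 1
  -- on the top monomial.
  have h1 := ExteriorAlgebra.liftAlternating_apply_ιMulti (R := ZMod 3) (N := ZMod 3)
    (Pi.single 3 Matrix.detRowAlternating)
    (fun i : Fin 3 => (Pi.single i 1 : Fin 3 → ZMod 3))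
  have h2 : ExteriorAlgebra.ιMulti (ZMod 3) 3 (fun i : Fin 3 => (Pi.single i 1 : Fin 3 → ZMod 3))
      = extGen 0 * (extGen 1 * extGen 2) := by
    rw [ExteriorAlgebra.ιMulti_apply]
    simp only [List.ofFn_succ, List.ofFn_zero, List.prod_cons, List.prod_nil, mul_one]
    rfl
  rw [h2, h, map_zero] at h1
  have h3 : (Matrix.of fun i : Fin 3 => (Pi.single i 1 : Fin 3 → ZMod 3)) = 1 := by
    ext i j
    simp [Matrix.one_apply, Pi.single_apply, eq_comm]
  have h4 : Matrix.det (fun i : Fin 3 => (Pi.single i 1 : Fin 3 → ZMod 3)) = 1 := by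
    rw [← Matrix.det_one (n := Fin 3) (R := ZMod 3), ← h3]
    rfl
  rw [Pi.single_eq_same] at h1
  exact zero_ne_one (h1.trans h4)

theorem ι_eq_sum (m : Fin 3 → ZMod 3) :
    ExteriorAlgebra.ι (ZMod 3) m = m 0 • extGen 0 + m 1 • extGen 1 + m 2 • extGen 2 := by
  rw [extGen, extGen, extGen, ← map_smul, ← map_smul, ← map_smul, ← map_add, ← map_add]
  congr 1
  ext i
  fin_cases i <;> simp

theorem extGen_mul_left_self (i : Fin 3) (a : ExtF3 3) : extGen i * (extGen i * a) = 0 := by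
  rw [← mul_assoc, extGen_sq, zero_mul]

theorem extGen_mul_left_comm (i j : Fin 3) (a : ExtF3 3) :
    extGen j * (extGen i * a) = -(extGen i * (extGen j * a)) := by
  rw [← mul_assoc, extGen_anticomm, neg_mul, mul_assoc]

/-- Every element of the exterior algebra is a combination of the standard monomials. -/
theorem exists_extGen_repr (a : ExtF3 3) : ∃ c c0 c1 c2 c01 c02 c12 c012 : ZMod 3,
    a = c • (1 : ExtF3 3) + c0 • extGen 0 + c1 • extGen 1 + c2 • extGen 2 +
      c01 • (extGen 0 * extGen 1) + c02 • (extGen 0 * extGen 2) + c12 • (extGen 1 * extGen 2) +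
      c012 • (extGen 0 * (extGen 1 * extGen 2)) := by
  induction a using CliffordAlgebra.left_induction with
  | algebraMap r => exact ⟨r, 0, 0, 0, 0, 0, 0, 0, by simp [Algebra.algebraMap_eq_smul_one]⟩
  | add x y hx hy =>
    obtain ⟨c, c0, c1, c2, c01, c02, c12, c012, rfl⟩ := hx
    obtain ⟨d, d0, d1, d2, d01, d02, d12, d012, rfl⟩ := hy
    exact ⟨c + d, c0 + d0, c1 + d1, c2 + d2, c01 + d01, c02 + d02, c12 + d12, c012 + d012,
      by module⟩
  | ι_mul x m hx =>
    obtain ⟨c, c0, c1, c2, c01, c02, c12, c012, rfl⟩ := hx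
    refine ⟨0, m 0 * c, m 1 * c, m 2 * c, m 0 * c1 - m 1 * c0, m 0 * c2 - m 2 * c0,
      m 1 * c2 - m 2 * c1, m 0 * c12 - m 1 * c02 + m 2 * c01, ?_⟩
    change ExteriorAlgebra.ι (ZMod 3) m * _ = _
    rw [ι_eq_sum]
    simp only [mul_add, add_mul, smul_mul_assoc, mul_smul_comm, extGen_sq, mul_one,
      extGen_anticomm 0 1, extGen_anticomm 0 2, extGen_anticomm 1 2, extGen_mul_left_self,
      extGen_mul_left_comm 0 1, extGen_mul_left_comm 0 2, extGen_mul_left_comm 1 2, mul_neg,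
      mul_zero, neg_zero]
    module

theorem mem_center_of_commute_extGen {a : ExtF3 3} (h : ∀ i, extGen i * a = a * extGen i) :
    a ∈ Subring.center (ExtF3 3) := by
  rw [Subring.mem_center_iff]
  intro g
  induction g using CliffordAlgebra.left_induction with
  | algebraMap r => exact Algebra.commutes r a
  | add x y hx hy => rw [add_mul, mul_add, hx, hy]
  | ι_mul x m hx =>
    rw [mul_assoc, hx, ← mul_assoc, ← mul_assoc]
    congr 1
    change ExteriorAlgebra.ι (ZMod 3) m * a = a * ExteriorAlgebra.ι (ZMod 3) m
    rw [ι_eq_sum]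
    simp only [add_mul, mul_add, smul_mul_assoc, mul_smul_comm, h]

theorem extGen_mul_mem_center (i j : Fin 3) :
    extGen i * extGen j ∈ Subring.center (ExtF3 3) :=
  mem_center_of_commute_extGen fun k => by
    rw [extGen_mul_left_comm i k, extGen_anticomm j k, mul_neg, neg_neg, mul_assoc]

theorem smul_mem_center (c : ZMod 3) {a : ExtF3 3} (ha : a ∈ Subring.center (ExtF3 3)) :
    c • a ∈ Subring.center (ExtF3 3) := by
  rw [Subring.mem_center_iff] at ha ⊢
  intro g
  rw [mul_smul_comm, ha, smul_mul_assoc]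

/-- Every generator kills the top monomial on both sides. -/
theorem extGen_prod_mem_center :
    extGen 0 * (extGen 1 * extGen 2) ∈ Subring.center (ExtF3 3) :=
  mem_center_of_commute_extGen fun k => by
    have h := Subring.mem_center_iff.1 (extGen_mul_mem_center 1 2) (extGen k)
    rw [mul_assoc, ← h]
    fin_cases k
    · simp [extGen_mul_left_self]
    · simp [extGen_mul_left_self, extGen_mul_left_comm 0 1]
    · simp [extGen_sq, extGen_mul_left_comm 0 2, extGen_mul_left_comm 1 2]

theorem isCentrallyEssential_extF3 : IsCentrallyEssential (ExtF3 3) := by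
  -- Here w is the bivector complementary to the generator k, and d is the coefficient of that
  -- generator in a. If wa = 0, multiplying by the generator gives c = 0, and then d = 0.
  have key : ∀ (w a : ExtF3 3) (c d : ZMod 3) (k : Fin 3),
      w ∈ Subring.center (ExtF3 3) → extGen k * w = extGen 0 * (extGen 1 * extGen 2) →
      w * a = c • w + d • (extGen 0 * (extGen 1 * extGen 2)) → d ≠ 0 →
      ∃ c ∈ Subring.center (ExtF3 3), c * a ≠ 0 ∧ c * a ∈ Subring.center (ExtF3 3) := by
    intro w a c d k hw hkw hwa hd
    refine ⟨w, hw, fun h0 => ?_, ?_⟩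
    · rw [hwa] at h0
      have hk0 : extGen k * (extGen 0 * (extGen 1 * extGen 2)) = 0 := by
        rw [← hkw, extGen_mul_left_self]
      have h1 := congrArg (extGen k * ·) h0
      simp only [mul_add, mul_smul_comm, hkw, hk0, smul_zero, add_zero, mul_zero] at h1
      rw [(smul_eq_zero.1 h1).resolve_right extGen_prod_ne_zero, zero_smul, zero_add] at h0
      exact (smul_ne_zero hd extGen_prod_ne_zero) h0
    · rw [hwa]
      exact add_mem (smul_mem_center _ hw) (smul_mem_center _ extGen_prod_mem_center)
  rw [isCentrallyEssential_iff]
  intro a ha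
  obtain ⟨c, c0, c1, c2, c01, c02, c12, c012, rfl⟩ := exists_extGen_repr a
  by_cases h0 : c0 = 0
  · by_cases h1 : c1 = 0
    · by_cases h2 : c2 = 0
      · refine ⟨1, one_mem _, by rwa [one_mul], ?_⟩
        subst h0 h1 h2
        simp only [zero_smul, add_zero, one_mul]
        exact add_mem (add_mem (add_mem (add_mem (smul_mem_center _ (one_mem _))
          (smul_mem_center _ (extGen_mul_mem_center _ _)))
          (smul_mem_center _ (extGen_mul_mem_center _ _)))
          (smul_mem_center _ (extGen_mul_mem_center _ _)))
          (smul_mem_center _ extGen_prod_mem_center)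
      · refine key (extGen 0 * extGen 1) _ c c2 2 (extGen_mul_mem_center _ _) ?_ ?_ h2
        · simp [extGen_mul_left_comm 0 2, extGen_anticomm 1 2]
        · subst h0 h1
          simp [mul_add, extGen_mul_left_comm 0 1, extGen_sq, extGen_mul_left_self, mul_assoc]
    · refine key (extGen 2 * extGen 0) _ c c1 1 (extGen_mul_mem_center _ _) ?_ ?_ ?_
      · simp [extGen_anticomm 0 2, extGen_mul_left_comm 0 1]
      · subst h0
        simp [mul_add, extGen_mul_left_comm 0 2, extGen_mul_left_comm 1 2, extGen_sq,
          extGen_mul_left_self, mul_assoc, extGen_anticomm 1 2, extGen_anticomm 0 2]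
      · exact h1
  · refine key (extGen 1 * extGen 2) _ c c0 0 (extGen_mul_mem_center _ _) rfl ?_ h0
    simp [mul_add, extGen_mul_left_comm 0 1, extGen_mul_left_comm 0 2, extGen_mul_left_comm 1 2,
      extGen_sq, extGen_mul_left_self, mul_assoc,
      extGen_anticomm 1 2, extGen_anticomm 0 2]

end Exterior
-- The exterior algebra of the plane: idempotents, and failure of central essentiality.
section Plane

theorem extGen_zero_mul_one_ne_zero : extGen 0 * extGen 1 ≠ 0 := by
  intro h
  apply extGen_prod_ne_zero
  rw [← mul_assoc, h, zero_mul]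

theorem exists_extGen_repr_of_mem_plane {a : ExtF3 3} (ha : a ∈ planeSubalgebra) :
    ∃ c c0 c1 c01 : ZMod 3, a = c • (1 : ExtF3 3) + c0 • extGen 0 + c1 • extGen 1 +
      c01 • (extGen 0 * extGen 1) := by
  obtain ⟨b, rfl⟩ := ha
  induction b using CliffordAlgebra.left_induction with
  | algebraMap r =>
    refine ⟨r, 0, 0, 0, ((ExteriorAlgebra.map _).commutes r).trans ?_⟩
    simp [Algebra.algebraMap_eq_smul_one]
  | add x y hx hy =>
    obtain ⟨c, c0, c1, c01, hx⟩ := hx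
    obtain ⟨d, d0, d1, d01, hy⟩ := hy
    refine ⟨c + d, c0 + d0, c1 + d1, c01 + d01, ?_⟩
    rw [map_add, hx, hy]
    module
  | ι_mul x m hx =>
    obtain ⟨c, c0, c1, c01, hx⟩ := hx
    refine ⟨0, m 0 * c, m 1 * c, m 0 * c1 - m 1 * c0, ?_⟩
    have hm : ∀ (f : (Fin 2 → ZMod 3) →ₗ[ZMod 3] (Fin 3 → ZMod 3)) (y : ExtF3 2),
        ExteriorAlgebra.map f (ExteriorAlgebra.ι (ZMod 3) m * y) =
          ExteriorAlgebra.ι (ZMod 3) (f m) * ExteriorAlgebra.map f y := fun f y => by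
      rw [map_mul, ExteriorAlgebra.map_apply_ι]
    refine (hm _ x).trans ((congrArg (_ * ·) hx).trans ?_)
    have h0 : Function.ExtendByZero.linearMap (ZMod 3) (Fin.castSucc : Fin 2 → Fin 3) m 0 = m 0 :=
      (Fin.castSucc_injective 2).extend_apply m 0 0
    have h1 : Function.ExtendByZero.linearMap (ZMod 3) (Fin.castSucc : Fin 2 → Fin 3) m 1 = m 1 :=
      (Fin.castSucc_injective 2).extend_apply m 0 1
    have h2 : Function.ExtendByZero.linearMap (ZMod 3) (Fin.castSucc : Fin 2 → Fin 3) m 2 = 0 :=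
      Function.extend_apply' _ _ _ (by decide)
    rw [ι_eq_sum, h0, h1, h2]
    simp only [mul_add, add_mul, smul_mul_assoc, mul_smul_comm, extGen_sq, mul_one,
      extGen_anticomm 0 1, extGen_mul_left_self, extGen_mul_left_comm 0 1, mul_zero, neg_zero,
      zero_smul, add_zero, smul_zero, smul_neg]
    module

theorem extGen_castSucc_mem_plane (i : Fin 2) : extGen i.castSucc ∈ planeSubalgebra := by
  refine ⟨ExteriorAlgebra.ι (ZMod 3) (Pi.single i 1), ?_⟩
  refine (ExteriorAlgebra.map_apply_ι _ _).trans ?_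
  rw [extGen]
  congr 1
  ext j
  change Function.extend Fin.castSucc (Pi.single i 1) 0 j = _
  have h2 : ∀ (i : Fin 2), Function.extend Fin.castSucc (Pi.single i (1 : ZMod 3)) 0 (2 : Fin 3) =
      0 := fun i => Function.extend_apply' _ _ _ (by decide)
  induction j using Fin.lastCases with
  | last =>
    refine (h2 i).trans ?_
    fin_cases i <;> rfl
  | cast j =>
    rw [(Fin.castSucc_injective 2).extend_apply]
    simp [Pi.single_apply]

theorem hasOnlyTrivialIdempotents_plane : HasOnlyTrivialIdempotents planeSubalgebra := by
  rintro ⟨e, he⟩ hidem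
  have hee : e * e = e := congrArg Subtype.val hidem
  rw [Subtype.ext_iff, Subtype.ext_iff]
  change e = 0 ∨ e = 1
  obtain ⟨c, c0, c1, c01, rfl⟩ := exists_extGen_repr_of_mem_plane he
  -- The part n without constant term has n² = 0, so (c + n)² = c² + 2cn; for c = 1, idempotence
  -- gives n = 0.
  have hsq : ∀ c c0 c1 c01 : ZMod 3,
      (c • (1 : ExtF3 3) + c0 • extGen 0 + c1 • extGen 1 + c01 • (extGen 0 * extGen 1)) *
      (c • (1 : ExtF3 3) + c0 • extGen 0 + c1 • extGen 1 + c01 • (extGen 0 * extGen 1)) =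
      (c * c) • (1 : ExtF3 3) + (2 * c) • (c0 • extGen 0 + c1 • extGen 1 +
        c01 • (extGen 0 * extGen 1)) := by
    intro c c0 c1 c01
    simp only [mul_add, add_mul, smul_mul_assoc, mul_smul_comm, extGen_sq, mul_one, one_mul,
      extGen_anticomm 0 1, extGen_mul_left_self, extGen_mul_left_comm 0 1, mul_neg, mul_assoc,
      mul_zero, neg_zero]
    module
  -- Multiplying by the top monomial of Λ(F³) reads off the constant term.
  have hmul : ∀ c c0 c1 c01 : ZMod 3, (extGen 0 * (extGen 1 * extGen 2)) *
      (c • (1 : ExtF3 3) + c0 • extGen 0 + c1 • extGen 1 + c01 • (extGen 0 * extGen 1)) =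
      c • (extGen 0 * (extGen 1 * extGen 2)) := by
    intro c c0 c1 c01
    simp [mul_add, mul_assoc, extGen_mul_left_comm 0 2, extGen_mul_left_comm 0 1,
      extGen_anticomm 0 2, extGen_anticomm 1 2, extGen_mul_left_self]
  have hcc : c * c = c := by
    have h := congrArg ((extGen 0 * (extGen 1 * extGen 2)) * ·) hee
    simp only [← mul_assoc _ (_ + _) (_ + _)] at h
    rw [hmul, smul_mul_assoc, hmul, smul_smul] at h
    exact smul_left_injective _ extGen_prod_ne_zero h
  rw [hsq, hcc] at hee
  obtain rfl | rfl : c = 0 ∨ c = 1 := by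
    revert hcc
    clear * -
    revert c
    decide
  · left
    rw [← hee]
    simp
  · right
    have h2 : c0 • extGen 0 + c1 • extGen 1 + c01 • (extGen 0 * extGen 1) = 0 := by
      rw [← sub_eq_zero] at hee
      rw [← hee]
      module
    rw [add_assoc, add_assoc, ← add_assoc (c0 • _), h2, one_smul, add_zero]

theorem not_isCentrallyEssential_plane : ¬ IsCentrallyEssential planeSubalgebra := by
  rw [isCentrallyEssential_iff]
  intro h
  -- Anticommutation turns this into 2c = 0, and the characteristic is not 2.
  have hdouble : ∀ c : ZMod 3, c • (extGen 0 * extGen 1) = c • (extGen 1 * extGen 0) → c = 0 := by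
    intro c hc
    rw [extGen_anticomm 0 1, smul_neg, eq_neg_iff_add_eq_zero, ← add_smul] at hc
    have := (smul_eq_zero.1 hc).resolve_right extGen_zero_mul_one_ne_zero
    clear hc
    revert c
    decide
  have h0ne : extGen 0 ≠ 0 := fun h0 => extGen_zero_mul_one_ne_zero (by rw [h0, zero_mul])
  obtain ⟨⟨z, hz⟩, hzC, hne, hzx⟩ := h ⟨extGen 0, extGen_castSucc_mem_plane 0⟩
    (fun h0 => h0ne (congrArg Subtype.val h0))
  rw [Subring.mem_center_iff] at hzC hzx
  have e1 : extGen 0 * z = z * extGen 0 :=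
    congrArg Subtype.val (hzC ⟨extGen 0, extGen_castSucc_mem_plane 0⟩)
  have e2 : extGen 1 * (z * extGen 0) = z * extGen 0 * extGen 1 :=
    congrArg Subtype.val (hzx ⟨extGen 1, extGen_castSucc_mem_plane 1⟩)
  have hne' : z * extGen 0 ≠ 0 := fun h0 => hne (Subtype.ext h0)
  obtain ⟨c, c0, c1, c01, rfl⟩ := exists_extGen_repr_of_mem_plane hz
  -- Commuting with e₀ removes the e₁ term of z, so ze₀ = c·e₀; this commutes with e₁ only if c = 0.
  have hc1 : c1 = 0 := by
    apply hdouble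
    simpa [mul_add, add_mul, extGen_sq, mul_assoc, extGen_mul_left_self, extGen_anticomm 0 1]
      using e1
  have hzx0 : (c • (1 : ExtF3 3) + c0 • extGen 0 + c1 • extGen 1 + c01 • (extGen 0 * extGen 1)) *
      extGen 0 = c • extGen 0 := by
    simp [hc1, add_mul, mul_assoc, extGen_sq, extGen_mul_left_self, extGen_anticomm 0 1]
  rw [hzx0] at e2 hne'
  have hc : c = 0 := hdouble c (by simpa using e2.symm)
  exact hne' (by rw [hc, zero_smul])

end Plane

/-! ### The ring of sequences and its quotient by the eventually zero ones. -/

section SeqRing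

theorem isCentrallyEssential_seqRing : IsCentrallyEssential seqRing := by
  have hE := isCentrallyEssential_extF3
  rw [isCentrallyEssential_iff] at hE ⊢
  rintro ⟨a, ha⟩ hne
  obtain ⟨i, hi⟩ : ∃ i, a i ≠ 0 := by
    by_contra! h
    exact hne (Subtype.ext (funext h))
  obtain ⟨c, hc, hca0, hca⟩ := hE _ hi
  -- The eventual value is 0, so b need not lie in the plane subalgebra.
  have hsingle : ∀ b, (Pi.single i b : ℕ → ExtF3 3) ∈ seqRing := fun b =>
    ⟨0, zero_mem _, i + 1, fun n hn => Pi.single_eq_of_ne (by omega) _⟩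
  have hcenter : ∀ b (hb : b ∈ Subring.center (ExtF3 3)),
      (⟨Pi.single i b, hsingle b⟩ : seqRing) ∈ Subring.center seqRing := by
    intro b hb
    rw [Subring.mem_center_iff] at hb ⊢
    rintro ⟨g, hg⟩
    refine Subtype.ext (funext fun n => ?_)
    change g n * (Pi.single i b : ℕ → ExtF3 3) n = (Pi.single i b : ℕ → ExtF3 3) n * g n
    by_cases hn : n = i
    · subst hn
      rw [Pi.single_eq_same, hb]
    · rw [Pi.single_eq_of_ne hn, mul_zero, zero_mul]
  have hmul : (⟨Pi.single i c, hsingle c⟩ : seqRing) * ⟨a, ha⟩ =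
      ⟨Pi.single i (c * a i), hsingle _⟩ := by
    refine Subtype.ext (funext fun n => ?_)
    change (Pi.single i c : ℕ → ExtF3 3) n * a n = (Pi.single i (c * a i) : ℕ → ExtF3 3) n
    by_cases hn : n = i
    · subst hn
      rw [Pi.single_eq_same, Pi.single_eq_same]
    · rw [Pi.single_eq_of_ne hn, Pi.single_eq_of_ne hn, zero_mul]
  refine ⟨⟨Pi.single i c, hsingle c⟩, hcenter c hc, ?_, ?_⟩
  · rw [hmul]
    intro h0
    apply hca0
    have := congrFun (congrArg Subtype.val h0) i
    change (Pi.single i (c * a i) : ℕ → ExtF3 3) i = 0 at this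
    rwa [Pi.single_eq_same] at this
  · rw [hmul]
    exact hcenter _ hca

theorem isIdempotentElem_seqIdem (i : ℕ) : IsIdempotentElem (seqIdem i) := by
  refine Subtype.ext ?_
  change (Pi.single i 1 : ℕ → ExtF3 3) * Pi.single i 1 = Pi.single i 1
  rw [← Pi.single_mul, mul_one]

theorem seqIdem_mul_apply (i : ℕ) (a : seqRing) (n : ℕ) :
    (seqIdem i * a : seqRing).1 n = if n = i then a.1 n else 0 := by
  change (Pi.single i 1 : ℕ → ExtF3 3) n * a.1 n = _
  rw [Pi.single_apply]
  split_ifs <;> simp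

/-- The ideal of the sequences that are eventually zero. -/
def eventuallyZeroIdeal : TwoSidedIdeal seqRing :=
  .mk' {a | ∃ N : ℕ, ∀ n ≥ N, a.1 n = 0}
    ⟨0, fun _ _ => rfl⟩
    (by
      rintro x y ⟨N, hN⟩ ⟨M, hM⟩
      refine ⟨max N M, fun n hn => ?_⟩
      change x.1 n + y.1 n = 0
      rw [hN n (le_of_max_le_left hn), hM n (le_of_max_le_right hn), add_zero])
    (by
      rintro x ⟨N, hN⟩
      refine ⟨N, fun n hn => ?_⟩
      change -x.1 n = 0
      rw [hN n hn, neg_zero])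
    (by
      rintro x y ⟨N, hN⟩
      refine ⟨N, fun n hn => ?_⟩
      change x.1 n * y.1 n = 0
      rw [hN n hn, mul_zero])
    (by
      rintro x y ⟨N, hN⟩
      refine ⟨N, fun n hn => ?_⟩
      change x.1 n * y.1 n = 0
      rw [hN n hn, zero_mul])

theorem mem_eventuallyZeroIdeal {a : seqRing} :
    a ∈ eventuallyZeroIdeal ↔ ∃ N : ℕ, ∀ n ≥ N, a.1 n = 0 :=
  TwoSidedIdeal.mem_mk' _ _ _ _ _ _ a

theorem span_seqIdem : TwoSidedIdeal.span (Set.range seqIdem) = eventuallyZeroIdeal := by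
  apply le_antisymm
  · rw [TwoSidedIdeal.span_le]
    rintro _ ⟨i, rfl⟩
    exact mem_eventuallyZeroIdeal.2 ⟨i + 1, fun n hn => Pi.single_eq_of_ne (by omega) _⟩
  · intro a ha
    obtain ⟨N, hN⟩ := mem_eventuallyZeroIdeal.1 ha
    have hsum : a = ∑ i ∈ Finset.range N, seqIdem i * a := by
      refine Subtype.ext (funext fun n => ?_)
      rw [AddSubmonoidClass.coe_finsetSum, Finset.sum_apply]
      simp only [seqIdem_mul_apply, Finset.sum_ite_eq, Finset.mem_range]
      split_ifs with h
      · rfl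
      · exact hN n (not_lt.1 h)
    rw [hsum]
    exact sum_mem fun i _ => TwoSidedIdeal.mul_mem_right _ _ _
      (TwoSidedIdeal.subset_span ⟨i, rfl⟩)

/-- The constant sequences with value in the exterior algebra of the plane. -/
def constSeq : planeSubalgebra →+* seqRing where
  toFun s := ⟨fun _ => s, s, s.2, 0, fun _ _ => rfl⟩
  map_one' := rfl
  map_mul' _ _ := rfl
  map_zero' := rfl
  map_add' _ _ := rfl

/-- Each class is represented by the constant sequence of its eventual value, and a constant that is
eventually zero vanishes. -/
noncomputable def planeEquivQuotient :
    planeSubalgebra ≃+* QuotientBySpan (Set.range seqIdem) :=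
  RingEquiv.ofBijective
    ((TwoSidedIdeal.span (Set.range seqIdem)).ringCon.mk'.comp constSeq) (by
      constructor
      · intro s t hst
        have h1 : constSeq s - constSeq t ∈ TwoSidedIdeal.span (Set.range seqIdem) := by
          rw [← TwoSidedIdeal.rel_iff]
          exact (RingCon.eq _).1 hst
        rw [span_seqIdem, mem_eventuallyZeroIdeal] at h1
        obtain ⟨N, hN⟩ := h1
        exact Subtype.ext (sub_eq_zero.1 (hN N le_rfl))
      · intro q
        obtain ⟨⟨a, s, hs, N, hN⟩, rfl⟩ := RingCon.mk'_surjective _ q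
        refine ⟨⟨s, hs⟩, ?_⟩
        refine (RingCon.eq _).2 ?_
        rw [TwoSidedIdeal.rel_iff, span_seqIdem, mem_eventuallyZeroIdeal]
        refine ⟨N, fun n hn => ?_⟩
        change s - a n = 0
        rw [hN n hn, sub_self])

theorem HasOnlyTrivialIdempotents.of_ringEquiv {R S : Type*} [Ring R] [Ring S] (e : R ≃+* S)
    (h : HasOnlyTrivialIdempotents R) : HasOnlyTrivialIdempotents S := by
  intro x hx
  have := h (e.symm x) (hx.map e.symm)
  simpa using this

theorem seqRing_example :
    IsCentrallyEssential seqRing ∧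
      (∀ i : ℕ, IsIdempotentElem (seqIdem i) ∧ seqIdem i ∈ Subring.center seqRing) ∧
      TwoSidedIdeal.span (Set.range seqIdem) ≠ ⊤ ∧
      HasOnlyTrivialIdempotents (QuotientBySpan (Set.range seqIdem)) ∧
      ¬ IsCentrallyEssential (QuotientBySpan (Set.range seqIdem)) := by
  refine ⟨isCentrallyEssential_seqRing, fun i => ⟨isIdempotentElem_seqIdem i,
    isCentrallyEssential_seqRing.idempotent_mem_center (isIdempotentElem_seqIdem i)⟩, ?_,
    hasOnlyTrivialIdempotents_plane.of_ringEquiv planeEquivQuotient,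
    fun h => not_isCentrallyEssential_plane (h.of_ringEquiv planeEquivQuotient.symm)⟩
  intro h
  have h1 : (1 : seqRing) ∈ TwoSidedIdeal.span (Set.range seqIdem) := by rw [h]; trivial
  rw [span_seqIdem, mem_eventuallyZeroIdeal] at h1
  obtain ⟨N, hN⟩ := h1
  exact one_ne_zero (hN N le_rfl)

end SeqRing

theorem theorem1p5 :
    -- (1)
    (∀ (R : Type*) [Ring R], IsCentrallyEssential R →
      (IsLeftSemiArtinianRing R ∨ IsRightSemiArtinianRing R) →
        IsCommutativeRing (R ⧸ Ring.jacobson R) ∧ IsVonNeumannRegularRing (R ⧸ Ring.jacobson R)) ∧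
    -- (2)
    (∀ (R : Type*) [Ring R], IsCentrallyEssential R →
      (IsRightNonsingularRing R ∨ IsSemiprimeRing (Subring.center R)) →
        IsCommutativeRing R) ∧
    -- (3), the general assertion
    (∃ (R : Type) (_ : Ring R) (E : Set R), IsCentrallyEssential R ∧
      (∀ e ∈ E, IsIdempotentElem e ∧ e ∈ Subring.center R) ∧
      TwoSidedIdeal.span E ≠ ⊤ ∧
      HasOnlyTrivialIdempotents (QuotientBySpan E) ∧
      ¬ IsCentrallyEssential (QuotientBySpan E)) ∧
    -- (3), the explicit example
    (IsCentrallyEssential seqRing ∧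
      (∀ i : ℕ, IsIdempotentElem (seqIdem i) ∧ seqIdem i ∈ Subring.center seqRing) ∧
      TwoSidedIdeal.span (Set.range seqIdem) ≠ ⊤ ∧
      HasOnlyTrivialIdempotents (QuotientBySpan (Set.range seqIdem)) ∧
      ¬ IsCentrallyEssential (QuotientBySpan (Set.range seqIdem))) := by
  refine ⟨fun R _ hce h => hce.quotient_jacobson h, fun R _ hce h => ?_, ?_, seqRing_example⟩
  · refine hce.isCommutativeRing_of_reduced_center fun z hz hzz => ?_
    exact h.elim (fun h => h.eq_zero_of_sq_eq_zero hz hzz) fun h => h.eq_zero_of_sq_eq_zero hz hzz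
  · obtain ⟨h1, h2, h3⟩ := seqRing_example
    exact ⟨seqRing, inferInstance, Set.range seqIdem, h1, by rintro _ ⟨i, rfl⟩; exact h2 i, h3⟩
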